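/- Let $\mathbb K$ be a field, let $\lambda=(\lambda_1,\dots,\lambda_n)$ be a vector of positive integers with $\lambda_1=\cdots=\lambda_n$, and let $I_\lambda\subset\mathbb K[x_{ij}: 1\le i\le n,\ 0\le j\le\lambda_i]$ be the toric ideal of the rational normal scroll $S(\lambda)$, i.e. the kernel of the homomorphism $x_{ij}\mapsto s^jt_i$ to the Laurent polynomial ring $\mathbb K[s^{\pm1},t_1^{\pm1},\dots,t_n^{\pm1}]$. For an ideal $I\subset\mathbb K[\mathbf x]$ and $r\ge1$ let the $r$-th secant ideal be $$I^{\{r\}}=\Bigl(I(\mathbf y_1)+\cdots+I(\mathbf y_r)+\langle y_{1v}+\cdots+y_{rv}-x_v : v\rangle\Bigr)\cap\mathbb K[\mathbf x],$$ where $\mathbf y_1,\dots,\mathbf y_r$ are disjoint copies of the set $\mathbf x$ of variables, $v$ runs over the indices of the variables, and $I(\mathbf y_k)$ is the image of $I$ under $\mathbf x\mapsto\mathbf y_k$. Let $\prec$ be the lexicographic term order such that $x_{ij}\succ x_{kl}$ if $j<l$, or $j=l$ and $i<k$. Then $\prec$ is delightful for $I_\lambda$, that is, $$\mathrm{in}_\prec\bigl(I_\lambda^{\{r\}}\bigr)=\bigl(\mathrm{in}_\prec(I_\lambda)\bigr)^{\{r\}}\qquad\text{for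 all integers } r\ge2.$$ Moreover, let $G_\lambda$ be the complementary graph of the edge graph of the regular triangulation $\Delta_\prec$ of the configuration of exponent vectors of the monomials $s^jt_i$; here a set $F$ of variables is a simplex of $\Delta_\prec$ if and only if no power of $\prod_{v\in F}x_v$ lies in $\mathrm{in}_\prec(I_\lambda)$, and two distinct variables are adjacent in $G_\lambda$ if and only if no simplex of $\Delta_\prec$ contains both. Let $r\ge1$, and let $M^r$ be the matrix with rows $p=0,\dots,r$, with columns indexed by the pairs $(i,c)$ with $1\le i\le n$, $c\ge0$ and $c+r\le\lambda_i$, and with entry $x_{i,c+p}$ in row $p$ and column $(i,c)$ (a concatenation of Hankel matrices). Then every clique of size $r+1$ in $G_\lambda$ can be written as $\{x_{i_0j_0},\dots,x_{i_rj_r}\}$ with $j_0<\cdots<j_r$, and there is an $(r+1)\times(r+1)$ submatrix of $M^r$, given by $r+1$ distinct columns in some order, whose diagonal entries are $x_{i_0j_0},\dots,x_{i_rj_r}$ in this order and whose determinant is nonzero, lies in $I_\lambda^{\{r\}}$, and has $\prec$-leading term $x_{i_0j_0}\cdots x_{i_rj_r}$. -/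

import Mathlib

open MvPolynomial

noncomputable section

/-! ### Joins and secants of ideals -/

/-- The join `I₁ * ⋯ * Iᵣ` of ideals of `K[x]`: in the polynomial ring `K[x, y₁, …, yᵣ]`
(`Sum.inl v` indexes `x_v` and `Sum.inr (k, v)` indexes `y_{k v}`), take the ideal generated by
the copies `I_k(y_k)` and the linear forms `∑ₖ y_{k v} - x_v`, and intersect it with `K[x]`. -/
def joinIdeal {σ K : Type*} [Field K] {r : ℕ} (I : Fin r → Ideal (MvPolynomial σ K)) :
    Ideal (MvPolynomial σ K) :=
  Ideal.comap (rename Sum.inl : MvPolynomial σ K →ₐ[K] MvPolynomial (σ ⊕ Fin r × σ) K)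
    ((⨆ k : Fin r, Ideal.map
        (rename fun v => Sum.inr (k, v) :
          MvPolynomial σ K →ₐ[K] MvPolynomial (σ ⊕ Fin r × σ) K) (I k)) ⊔
      Ideal.span (Set.range fun v : σ =>
        (∑ k : Fin r, X (Sum.inr (k, v)) - X (Sum.inl v) :
          MvPolynomial (σ ⊕ Fin r × σ) K)))

/-- The `r`-th secant `I^{r}` of an ideal: the `r`-fold join of `I` with itself. -/
def secantIdeal {σ K : Type*} [Field K] (r : ℕ) (I : Ideal (MvPolynomial σ K)) :
    Ideal (MvPolynomial σ K) :=
  joinIdeal fun _ : Fin r => I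

/-! ### Initial ideals and delightful term orders -/

/-- The initial ideal of `I`, generated by the leading terms of the elements of `I`. -/
def initialIdeal {σ K : Type*} [Field K] (m : MonomialOrder σ) (I : Ideal (MvPolynomial σ K)) :
    Ideal (MvPolynomial σ K) :=
  Ideal.span (m.leadingTerm '' (I : Set (MvPolynomial σ K)))

/-- The term order `m` is `r`-delightful for `I`: the initial ideal of the `r`-th secant of `I`
is the `r`-th secant of the initial ideal of `I`. -/
def IsRDelightful {σ K : Type*} [Field K] (m : MonomialOrder σ) (r : ℕ)
    (I : Ideal (MvPolynomial σ K)) : Prop :=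
  initialIdeal m (secantIdeal r I) = secantIdeal r (initialIdeal m I)

/-- The term order `m` is delightful for `I`: it is `r`-delightful for all `r ≥ 2`. -/
def IsDelightful {σ K : Type*} [Field K] (m : MonomialOrder σ)
    (I : Ideal (MvPolynomial σ K)) : Prop :=
  ∀ r : ℕ, 2 ≤ r → IsRDelightful m r I

/-! ### Toric ideals and the triangulations given by term orders -/

/-- The toric ideal of a vector configuration `A`: the kernel of the homomorphism
`x_v ↦ t ^ (A v)` to the ring of Laurent polynomials, which is the group algebra of `ℤ^ι`. -/
def toricIdeal (K : Type*) [Field K] {σ ι : Type*} (A : σ → ι → ℤ) :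
    Ideal (MvPolynomial σ K) :=
  RingHom.ker (aeval fun v => AddMonoidAlgebra.single (A v) (1 : K) :
    MvPolynomial σ K →ₐ[K] AddMonoidAlgebra K (ι → ℤ))

/-- The simplices of the regular triangulation of the configuration `A` given by the term order
`m`: the sets `F` such that every power of `∏_{v ∈ F} x_v` is a standard monomial modulo the
initial ideal of the toric ideal of `A`. -/
def toricTriangulation (K : Type*) [Field K] {σ ι : Type*} (m : MonomialOrder σ)
    (A : σ → ι → ℤ) : Set (Finset σ) :=
  {F | ∀ k : ℕ, (∏ v ∈ F, (X v : MvPolynomial σ K)) ^ k ∉ initialIdeal m (toricIdeal K A)}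

/-- The complementary graph of the edge graph of that triangulation. -/
def complementaryGraph (K : Type*) [Field K] {σ ι : Type*} (m : MonomialOrder σ)
    (A : σ → ι → ℤ) : SimpleGraph σ where
  Adj v w := v ≠ w ∧ ∀ F ∈ toricTriangulation K m A, ¬ (v ∈ F ∧ w ∈ F)
  symm := ⟨fun _ _ h => ⟨h.1.symm, fun F hF hvw => h.2 F hF hvw.symm⟩⟩
  loopless := ⟨fun _ h => h.1 rfl⟩

/-! ### Rational normal scrolls -/

/-- The indices `(i, j)`, `0 ≤ j ≤ λ_i`, of the variables `x_{ij}` of the scroll `S(λ)`. -/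
@[ext]
structure ScrollVar {n : ℕ} (lam : Fin n → ℕ) where
  i : Fin n
  j : ℕ
  j_le : j ≤ lam i

namespace ScrollVar

variable {n : ℕ} {lam : Fin n → ℕ}

theorem key_injective :
    Function.Injective (fun v : ScrollVar lam => toLex (v.j, v.i)) := by
  intro v w h
  have h' := Prod.ext_iff.1 (toLex.injective h)
  exact ScrollVar.ext h'.2 h'.1

/-- Indices `(i, j)` are compared by `j` first, and by `i` if the values of `j` agree. -/
instance : LinearOrder (ScrollVar lam) :=
  LinearOrder.lift' (fun v => toLex (v.j, v.i)) key_injective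

instance : Finite (ScrollVar lam) :=
  Finite.of_injective
    (fun v => (⟨v.i, ⟨v.j, Nat.lt_succ_of_le v.j_le⟩⟩ : Σ i : Fin n, Fin (lam i + 1))) (by
      intro v w h
      have h₁ : v.i = w.i := congrArg (fun p => p.1) h
      have h₂ : v.j = w.j := congrArg (fun p => (p.2 : ℕ)) h
      exact ScrollVar.ext h₁ h₂)

theorem lt_iff (v w : ScrollVar lam) : v < w ↔ v.j < w.j ∨ v.j = w.j ∧ v.i < w.i :=
  Prod.Lex.toLex_lt_toLex (x := (v.j, v.i)) (y := (w.j, w.i))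

end ScrollVar

/-- The lexicographic term order on `K[x_{ij}]` with `x_{ij} ≻ x_{kl}` if `j < l`, or `j = l` and
`i < k`. (In `MonomialOrder.lex` a smaller index means a larger variable.) -/
def scrollOrder {n : ℕ} (lam : Fin n → ℕ) : MonomialOrder (ScrollVar lam) :=
  MonomialOrder.lex

theorem scrollOrder_single_lt_iff {n : ℕ} {lam : Fin n → ℕ} (v w : ScrollVar lam) :
    (scrollOrder lam).toSyn (Finsupp.single w 1) < (scrollOrder lam).toSyn (Finsupp.single v 1) ↔
      v.j < w.j ∨ v.j = w.j ∧ v.i < w.i :=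
  Finsupp.Lex.single_lt_iff.trans (ScrollVar.lt_iff v w)

/-- The configuration of the scroll: the vector of `x_{ij}` is `j e₀ ⊕ e_i` in `ℤ^{n+1}`. -/
def scrollConfig {n : ℕ} (lam : Fin n → ℕ) (v : ScrollVar lam) : Fin (n + 1) → ℤ :=
  Pi.single 0 (v.j : ℤ) + Pi.single v.i.succ 1

/-- The ideal `I_λ` of the rational normal scroll `S(λ)`, parametrized by `x_{ij} = s^j t_i`. -/
def scrollIdeal (K : Type*) [Field K] {n : ℕ} (lam : Fin n → ℕ) :
    Ideal (MvPolynomial (ScrollVar lam) K) :=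
  toricIdeal K (scrollConfig lam)

/-- The concatenated Hankel matrix `M^r = (M^{1,r} | ⋯ | M^{n,r})` with `r + 1` rows. Its columns
are indexed by pairs `⟨i, c⟩` with `c + r ≤ λ_i` (so the block `i` has `λ_i - r + 1` columns
if `r ≤ λ_i` and none otherwise), and its entry in row `p` and column `⟨i, c⟩` is
`x_{i, c + p}`. -/
def scrollHankel (K : Type*) [Field K] {n : ℕ} (lam : Fin n → ℕ) (r : ℕ) :
    Matrix (Fin (r + 1)) (Σ i : Fin n, {c : ℕ // c + r ≤ lam i})
      (MvPolynomial (ScrollVar lam) K) :=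
  fun p col => X ⟨col.1, col.2.1 + p,
    (Nat.add_le_add_left (Nat.le_of_lt_succ p.2) _).trans col.2.2⟩

end

/-! Both sides of the delightful identity equal the ideal of monomials whose support contains a
chain of `r + 1` variables for the strict partial order `scrollRel`. For `(in I)^{r}` this is
perfection of comparability graphs: a set without such a chain splits into `r` antichains
(`secantIdeal_chainIdeal_one`). For `in (I^{r})`, suppose the leading monomial of `f` in the secant
had no such chain. Colour it by `r` antichains and substitute `x_v = ∑ₖ y_{kv}`. Each colour part is
the smallest monomial of its multidegree (`scrollOrder_le_of_weight_eq`), but the toric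
parametrization forces a second monomial of the same multidegrees. Multiplying its parts together
gives a larger monomial of `f`, a contradiction (`hasChain_degree_of_mem_secantIdeal`). Conversely,
a chain is the diagonal of a Hankel minor (`exists_minor_of_chain`). The minor lies in the secant
because a sum of `r` matrices of rank at most one has no nonzero minor of size `r + 1`. The case `r
= 1` gives `in I` itself, and hence relates edges of the complementary graph to chains. -/

/-! ### Joins of ideals through sums of algebra-valued points -/

theorem aeval_sum_eq_zero_of_mem_joinIdeal {σ K B : Type*} [Field K] [CommRing B] [Algebra K B]
    {r : ℕ} {I : Fin r → Ideal (MvPolynomial σ K)} {f : MvPolynomial σ K} (hf : f ∈ joinIdeal I)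
    (g : Fin r → σ → B) (hg : ∀ k, ∀ p ∈ I k, aeval (g k) p = 0) :
    aeval (fun v => ∑ k, g k v) f = 0 := by
  let H : MvPolynomial (σ ⊕ Fin r × σ) K →ₐ[K] B :=
    aeval (Sum.elim (fun v => ∑ k, g k v) fun p => g p.1 p.2)
  have hle : ((⨆ k : Fin r, Ideal.map
        (rename fun v => Sum.inr (k, v) :
          MvPolynomial σ K →ₐ[K] MvPolynomial (σ ⊕ Fin r × σ) K) (I k)) ⊔
      Ideal.span (Set.range fun v : σ =>
        (∑ k : Fin r, X (Sum.inr (k, v)) - X (Sum.inl v) :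
          MvPolynomial (σ ⊕ Fin r × σ) K))) ≤ RingHom.ker H := by
    refine sup_le (iSup_le fun k => Ideal.map_le_iff_le_comap.2 fun p hp => ?_)
      (Ideal.span_le.2 ?_)
    · rw [Ideal.mem_comap, RingHom.mem_ker]
      change H (rename _ p) = 0
      rw [aeval_rename]
      exact hg k p hp
    · rintro _ ⟨v, rfl⟩
      simp [H]
  have h := hle hf
  rw [RingHom.mem_ker] at h
  change H (rename _ f) = 0 at h
  rw [aeval_rename] at h
  exact h

universe u v in
theorem mem_joinIdeal_of_forall_aeval {σ : Type u} {K : Type v} [Field K] {r : ℕ}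
    {I : Fin r → Ideal (MvPolynomial σ K)} {f : MvPolynomial σ K}
    (h : ∀ (B : Type (max u v)) [CommRing B] [Algebra K B] (g : Fin r → σ → B),
      (∀ k, ∀ p ∈ I k, aeval (g k) p = 0) → aeval (fun v => ∑ k, g k v) f = 0) :
    f ∈ joinIdeal I := by
  set J : Ideal (MvPolynomial (σ ⊕ Fin r × σ) K) := ((⨆ k : Fin r, Ideal.map
        (rename fun v => Sum.inr (k, v) :
          MvPolynomial σ K →ₐ[K] MvPolynomial (σ ⊕ Fin r × σ) K) (I k)) ⊔
      Ideal.span (Set.range fun v : σ =>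
        (∑ k : Fin r, X (Sum.inr (k, v)) - X (Sum.inl v) :
          MvPolynomial (σ ⊕ Fin r × σ) K))) with hJ
  -- The universal point: the classes of the `y_{kv}` modulo the defining ideal, where their sum
  -- over `k` is the class of `x_v`.
  have key := h (MvPolynomial (σ ⊕ Fin r × σ) K ⧸ J)
    (fun k v => Ideal.Quotient.mkₐ K J (X (Sum.inr (k, v)))) (by
      intro k p hp
      have : aeval (fun v => Ideal.Quotient.mkₐ K J (X (Sum.inr (k, v)))) p =
          Ideal.Quotient.mkₐ K J (rename (fun v => Sum.inr (k, v)) p) := by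
        rw [rename_eq_aeval, ← comp_aeval_apply]
        rfl
      rw [this]
      refine Ideal.Quotient.eq_zero_iff_mem.2 ?_
      exact Ideal.mem_sup_left (Ideal.mem_iSup_of_mem k (Ideal.mem_map_of_mem _ hp)))
  have hsum : (fun v => ∑ k, Ideal.Quotient.mkₐ K J (X (Sum.inr (k, v)))) =
      fun v => Ideal.Quotient.mkₐ K J (X (Sum.inl v)) := by
    funext v
    rw [← map_sum]
    refine Ideal.Quotient.eq.2 (Ideal.mem_sup_right (Ideal.subset_span ⟨v, rfl⟩))
  rw [hsum] at key
  have h2 : aeval (fun v => Ideal.Quotient.mkₐ K J (X (Sum.inl v))) f =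
      Ideal.Quotient.mkₐ K J (rename Sum.inl f) := by
    rw [rename_eq_aeval, ← comp_aeval_apply]
    rfl
  rw [h2] at key
  have h3 : rename Sum.inl f ∈ J := Ideal.Quotient.eq_zero_iff_mem.1 key
  exact h3

theorem secantIdeal_one {σ K : Type*} [Field K] (I : Ideal (MvPolynomial σ K)) :
    secantIdeal 1 I = I := by
  refine le_antisymm (fun f hf => ?_) fun f hf => mem_joinIdeal_of_forall_aeval ?_
  · have hmk : ∀ p : MvPolynomial σ K,
        aeval (fun v => Ideal.Quotient.mkₐ K I (X v)) p = Ideal.Quotient.mkₐ K I p := fun p => by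
      rw [← comp_aeval_apply, aeval_X_left_apply]
    have := aeval_sum_eq_zero_of_mem_joinIdeal hf
      (fun _ v => Ideal.Quotient.mkₐ K I (X v)) (fun k p hp => by
        rw [hmk]
        exact Ideal.Quotient.eq_zero_iff_mem.2 hp)
    simp only [Finset.univ_unique, Finset.sum_singleton] at this
    rw [hmk] at this
    exact Ideal.Quotient.eq_zero_iff_mem.1 this
  · intro B _ _ g hg
    simpa using hg 0 f hf

/-! ### Chains, antichains and secants of comparability edge ideals -/

/-- The finite set `s` contains an `R`-chain with `r + 1` elements. -/
def HasChain {σ : Type*} (R : σ → σ → Prop) (r : ℕ) (s : Finset σ) : Prop :=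
  ∃ c : Fin (r + 1) → σ, (∀ a b, a < b → R (c a) (c b)) ∧ ∀ a, c a ∈ s

theorem HasChain.mono {σ : Type*} {R : σ → σ → Prop} {r : ℕ} {s t : Finset σ}
    (h : HasChain R r s) (hst : s ⊆ t) : HasChain R r t :=
  let ⟨c, hc, hs⟩ := h
  ⟨c, hc, fun a => hst (hs a)⟩

/-- A finite set without chains of `r + 1` elements is a union of `r` antichains. -/
theorem exists_antichain_coloring {σ : Type*} {R : σ → σ → Prop} [Std.Irrefl R] [IsTrans σ R]
    (r : ℕ) (s : Finset σ) (hs : ¬ HasChain R r s) :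
    ∃ c : σ → ℕ, (∀ v ∈ s, c v < r) ∧ ∀ v ∈ s, ∀ w ∈ s, c v = c w → ¬ R v w := by
  classical
  induction r generalizing s with
  | zero =>
    have : ∀ v, v ∉ s := fun v hv =>
      hs ⟨fun _ => v, fun a b hab => absurd hab (by omega), fun _ => hv⟩
    exact ⟨fun _ => 0, fun v hv => absurd hv (this v), fun v hv => absurd hv (this v)⟩
  | succ r ih =>
    -- The minimal elements of `s` form one antichain. A chain among the other elements can be
    -- prolonged downwards in `s`, so `t` has no chain of `r + 1` elements.
    set t := s.filter fun v => ∃ w ∈ s, R w v with ht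
    obtain ⟨c, hc, hR⟩ := ih t (by
      rintro ⟨c, hc, hm⟩
      obtain ⟨w, hw, hw0⟩ := (Finset.mem_filter.1 (hm 0)).2
      refine hs ⟨Fin.cons w c, fun a b hab => ?_, fun a => ?_⟩
      · obtain ⟨b, rfl⟩ := Fin.exists_succ_eq.2 (Fin.ne_zero_of_lt hab)
        cases a using Fin.cases with
        | zero =>
          rw [Fin.cons_zero, Fin.cons_succ]
          rcases (Fin.zero_le b).eq_or_lt with rfl | h
          · exact hw0
          · exact _root_.trans hw0 (hc _ _ h)
        | succ a => simpa using hc a b (Fin.succ_lt_succ_iff.1 hab)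
      · cases a using Fin.cases with
        | zero => exact hw
        | succ a => exact (Finset.mem_filter.1 (hm a)).1)
    refine ⟨fun v => if v ∈ t then c v + 1 else 0, fun v _ => ?_, fun v hv w hw hcw hvw => ?_⟩
    · beta_reduce
      split_ifs with h
      · exact Nat.succ_lt_succ (hc v h)
      · exact Nat.succ_pos r
    · have hwt : w ∈ t := Finset.mem_filter.2 ⟨hw, v, hv, hvw⟩
      by_cases hvt : v ∈ t
      · simp only [hvt, hwt, if_true] at hcw
        exact hR v hvt w hwt (by omega) hvw
      · simp [hvt, hwt] at hcw

/-- The ideal spanned by the monomials whose support contains an `R`-chain of `r + 1` elements. -/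
noncomputable def chainIdeal {σ : Type*} (K : Type*) [Field K] (R : σ → σ → Prop) (r : ℕ) :
    Ideal (MvPolynomial σ K) :=
  Ideal.span ((fun u => monomial u 1) '' {u : σ →₀ ℕ | HasChain R r u.support})

theorem mem_chainIdeal {σ K : Type*} [Field K] {R : σ → σ → Prop} {r : ℕ}
    {f : MvPolynomial σ K} :
    f ∈ chainIdeal K R r ↔ ∀ u ∈ f.support, HasChain R r u.support := by
  rw [chainIdeal, mem_ideal_span_monomial_image]
  refine forall₂_congr fun u _ => ⟨fun ⟨w, hw, hwu⟩ => ?_, fun h => ⟨u, h, le_rfl⟩⟩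
  exact HasChain.mono hw (Finsupp.support_mono hwu)

theorem prod_X_chain_dvd {σ K : Type*} [Field K] {R : σ → σ → Prop} [Std.Irrefl R] {r : ℕ}
    {c : Fin (r + 1) → σ} (hc : ∀ a b, a < b → R (c a) (c b)) {u : σ →₀ ℕ}
    (hu : ∀ a, c a ∈ u.support) : (∏ a, X (c a) : MvPolynomial σ K) ∣ monomial u 1 := by
  classical
  have hinj : Function.Injective c := by
    intro a b hab
    by_contra hne
    rcases lt_or_gt_of_ne hne with h | h
    · exact irrefl_of R _ (hab ▸ hc _ _ h)
    · exact irrefl_of R _ (hab ▸ hc _ _ h)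
  have h1 : (∏ a, X (c a) : MvPolynomial σ K) = ∏ v ∈ Finset.univ.image c, X v :=
    (Finset.prod_image fun a _ b _ h => hinj h).symm
  rw [h1, monomial_eq, C_1, one_mul, Finsupp.prod]
  refine (Finset.prod_dvd_prod_of_subset _ u.support _ fun v hv => ?_).trans
    (Finset.prod_dvd_prod_of_dvd _ _ fun v hv => dvd_pow_self _ (Finsupp.mem_support_iff.1 hv))
  obtain ⟨a, -, rfl⟩ := Finset.mem_image.1 hv
  exact hu a

theorem initialIdeal_eq_chainIdeal {σ K : Type*} [Field K] {R : σ → σ → Prop} [Std.Irrefl R]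
    {r : ℕ} (m : MonomialOrder σ) (J : Ideal (MvPolynomial σ K))
    (hdeg : ∀ f ∈ J, f ≠ 0 → HasChain R r (m.degree f).support)
    (hlead : ∀ c : Fin (r + 1) → σ, (∀ a b, a < b → R (c a) (c b)) →
      ∃ f ∈ J, m.leadingTerm f = ∏ a, X (c a)) :
    initialIdeal m J = chainIdeal K R r := by
  refine le_antisymm (Ideal.span_le.2 ?_) (Ideal.span_le.2 ?_)
  · rintro _ ⟨f, hf, rfl⟩
    by_cases h0 : f = 0
    · simp [h0]
    · refine mem_chainIdeal.2 fun u hu => ?_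
      rw [m.support_leadingTerm' h0, Finset.mem_singleton] at hu
      exact hu ▸ hdeg f hf h0
  · rintro _ ⟨u, ⟨c, hc, hu⟩, rfl⟩
    obtain ⟨f, hf, hfc⟩ := hlead c hc
    refine Ideal.mem_of_dvd _ (prod_X_chain_dvd hc hu) ?_
    rw [← hfc]
    exact Ideal.subset_span ⟨f, hf, rfl⟩

/-- Setting the variables outside `S` to zero keeps the coefficients of the monomials in `S`. -/
theorem coeff_aeval_ite {σ K : Type*} [Field K] (S : σ → Prop) [DecidablePred S]
    (f : MvPolynomial σ K) (u : σ →₀ ℕ) (hu : ∀ v ∈ u.support, S v) :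
    coeff u (aeval (fun v => if S v then (X v : MvPolynomial σ K) else 0) f) = coeff u f := by
  classical
  induction f using MvPolynomial.induction_on' with
  | add p q hp hq => rw [map_add, coeff_add, coeff_add, hp, hq]
  | monomial w a =>
    by_cases hw : ∀ v ∈ w.support, S v
    · rw [aeval_monomial, algebraMap_eq, monomial_eq, Finsupp.prod, Finsupp.prod,
        Finset.prod_congr rfl fun v hv => by rw [if_pos (hw v hv)]]
    · push Not at hw
      obtain ⟨v, hv, hvS⟩ := hw
      have hne : w ≠ u := fun h => hvS (hu v (h ▸ hv))
      rw [aeval_monomial, Finsupp.prod, Finset.prod_eq_zero hv, mul_zero, coeff_zero,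
        coeff_monomial, if_neg hne]
      rw [if_neg hvS, zero_pow (Finsupp.mem_support_iff.1 hv)]

/-- The secants of the edge ideal of a comparability graph are generated by the chains. -/
theorem secantIdeal_chainIdeal_one {σ K : Type*} [Field K] {R : σ → σ → Prop} [Std.Irrefl R]
    [IsTrans σ R] (r : ℕ) :
    secantIdeal r (chainIdeal K R 1) = chainIdeal K R r := by
  classical
  refine le_antisymm (fun f hf => ?_) (Ideal.span_le.2 ?_)
  · rw [mem_chainIdeal]
    intro u hu
    by_contra hch
    obtain ⟨c, hc, hR⟩ := exists_antichain_coloring r u.support hch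
    -- The `k`-th point keeps only the variables of colour `k`. It kills the edge ideal since colour
    -- classes are antichains, and the sum of the points keeps exactly the variables of `u`.
    have h0 := aeval_sum_eq_zero_of_mem_joinIdeal hf
      (fun k v => if v ∈ u.support ∧ c v = k then (X v : MvPolynomial σ K) else 0) (by
        intro k p hp
        have hle : chainIdeal K R 1 ≤ RingHom.ker (aeval
            (fun v => if v ∈ u.support ∧ c v = k then (X v : MvPolynomial σ K) else 0)) := by
          refine Ideal.span_le.2 ?_
          rintro _ ⟨w, ⟨e, he, hew⟩, rfl⟩
          refine Ideal.mem_of_dvd _ (prod_X_chain_dvd he hew) ?_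
          rw [RingHom.mem_ker, map_prod, Fin.prod_univ_two, aeval_X, aeval_X]
          split_ifs with h1 h2
          · exact absurd (he 0 1 (by decide)) (hR _ h1.1 _ h2.1 (h1.2.trans h2.2.symm))
          all_goals simp
        exact hle hp)
    have hsum : (fun v => ∑ k : Fin r,
        if v ∈ u.support ∧ c v = k then (X v : MvPolynomial σ K) else 0) =
        fun v => if v ∈ u.support then (X v : MvPolynomial σ K) else 0 := by
      funext v
      by_cases hv : v ∈ u.support
      · rw [if_pos hv, Finset.sum_eq_single (⟨c v, hc v hv⟩ : Fin r), if_pos ⟨hv, rfl⟩]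
        · intro k _ hk
          exact if_neg fun h => hk (Fin.ext h.2.symm)
        · simp
      · simp [hv]
    rw [hsum] at h0
    refine mem_support_iff.1 hu ?_
    rw [← coeff_aeval_ite (fun v => v ∈ u.support) f u fun _ h => h, h0, coeff_zero]
  · rintro _ ⟨u, ⟨c, hc, hu⟩, rfl⟩
    refine Ideal.mem_of_dvd _ (prod_X_chain_dvd hc hu) (mem_joinIdeal_of_forall_aeval ?_)
    intro B _ _ g hg
    simp only [map_prod, aeval_X]
    rw [Finset.prod_univ_sum]
    refine Finset.sum_eq_zero fun x _ => ?_
    -- Pigeonhole: `r + 1` chain elements are distributed over `r` points, so two related variables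
    -- are evaluated at the same point, which kills their product.
    obtain ⟨a, b, hab, hx⟩ : ∃ a b, a < b ∧ x a = x b := by
      obtain ⟨a, b, hne, hx⟩ := Fintype.exists_ne_map_eq_of_card_lt x (by simp)
      rcases lt_or_gt_of_ne hne with h | h
      · exact ⟨a, b, h, hx⟩
      · exact ⟨b, a, h, hx.symm⟩
    have hz : g (x a) (c a) * g (x b) (c b) = 0 := by
      have := hg (x a) (X (c a) * X (c b)) (by
        rw [mem_chainIdeal]
        intro w hw
        rw [X, X, monomial_mul, support_monomial, if_neg (by simp), Finset.mem_singleton] at hw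
        refine ⟨![c a, c b], ?_, ?_⟩
        · intro p q hpq
          fin_cases p <;> fin_cases q <;> first | exact hc a b hab | exact absurd hpq (by decide)
        · subst hw
          intro p
          fin_cases p <;> simp)
      simpa [hx] using this
    rw [← Finset.mul_prod_erase _ _ (Finset.mem_univ a),
      ← Finset.mul_prod_erase _ _ (Finset.mem_erase.2 ⟨hab.ne', Finset.mem_univ b⟩),
      ← mul_assoc, hz, zero_mul]

/-! ### Multidegrees and splitting of variables -/

theorem aeval_single_eq_sum {τ M K : Type*} [Field K] [AddCommMonoid M] (A : τ → M)
    (F : MvPolynomial τ K) :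
    aeval (fun v => (AddMonoidAlgebra.single (A v) 1 : AddMonoidAlgebra K M)) F =
      ∑ W ∈ F.support, AddMonoidAlgebra.single (Finsupp.weight A W) (coeff W F) := by
  classical
  conv_lhs => rw [F.as_sum, map_sum]
  refine Finset.sum_congr rfl fun W _ => ?_
  rw [aeval_monomial, Finsupp.weight_apply, Finsupp.sum, Finsupp.prod]
  have : ∀ s : Finset τ, ∏ v ∈ s, (AddMonoidAlgebra.single (A v) 1 : AddMonoidAlgebra K M) ^ W v =
      AddMonoidAlgebra.single (∑ v ∈ s, W v • A v) 1 := by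
    intro s
    induction s using Finset.induction_on with
    | empty => simp [AddMonoidAlgebra.one_def]
    | insert v s hv ih =>
      rw [Finset.prod_insert hv, Finset.sum_insert hv, ih, AddMonoidAlgebra.single_pow,
        AddMonoidAlgebra.single_mul_single, one_pow, one_mul]
  rw [this, ← Algebra.smul_def]
  simp

/-- The monomials of an element of a toric ideal share their degrees with other ones. -/
theorem exists_ne_weight_eq {τ M K : Type*} [Field K] [AddCommMonoid M] (A : τ → M)
    {F : MvPolynomial τ K}
    (hF : aeval (fun v => (AddMonoidAlgebra.single (A v) 1 : AddMonoidAlgebra K M)) F = 0)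
    {U : τ →₀ ℕ} (hU : U ∈ F.support) :
    ∃ W ∈ F.support, W ≠ U ∧ Finsupp.weight A W = Finsupp.weight A U := by
  classical
  by_contra! h
  rw [aeval_single_eq_sum] at hF
  have hc := congrArg (fun x => x.coeff (Finsupp.weight A U)) hF
  simp only [AddMonoidAlgebra.coeff_sum, AddMonoidAlgebra.coeff_single, Finsupp.finsetSum_apply,
    AddMonoidAlgebra.coeff_zero, Finsupp.zero_apply] at hc
  rw [Finset.sum_eq_single_of_mem U hU, Finsupp.single_eq_same] at hc
  · exact mem_support_iff.1 hU hc
  · intro W hW hne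
    exact Finsupp.single_eq_of_ne' (h W hW hne)

/-- The substitution `x_v ↦ ∑ₖ y_{k v}`. -/
noncomputable def splitVars {σ : Type*} (K : Type*) [Field K] (r : ℕ) :
    MvPolynomial σ K →ₐ[K] MvPolynomial (Fin r × σ) K :=
  aeval fun v => ∑ k, X (k, v)

/-- Giving every `y_{kv}` the weight `e_v` makes the image of `x^w` homogeneous of weight `w`, so
forgetting the index `k` recovers the original monomial. -/
theorem sum_curry_mem_support {σ K : Type*} [Field K] {r : ℕ} {f : MvPolynomial σ K}
    {W : Fin r × σ →₀ ℕ} (hW : W ∈ (splitVars K r f).support) :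
    ∑ k, W.curry k ∈ f.support := by
  classical
  let wt : Fin r × σ → (σ →₀ ℕ) := fun p => Finsupp.single p.2 1
  have hwt : ∀ W : Fin r × σ →₀ ℕ, Finsupp.weight wt W = ∑ k, W.curry k := by
    intro W
    induction W using Finsupp.induction_linear with
    | zero =>
      rw [map_zero]
      exact (Finset.sum_eq_zero fun k _ => by ext v; simp [Finsupp.curry_apply]).symm
    | add W W' h h' =>
      rw [map_add, h, h', ← Finset.sum_add_distrib]
      refine Finset.sum_congr rfl fun k _ => ?_
      ext v
      simp [Finsupp.curry_apply]
    | single p a =>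
      rw [Finsupp.weight_single]
      ext v
      obtain ⟨k, w⟩ := p
      simp [wt, Finsupp.single_apply]
  have hmon : ∀ (w : σ →₀ ℕ) (a : K),
      IsWeightedHomogeneous wt (splitVars K r (monomial w a)) w := by
    intro w a
    rw [splitVars, aeval_monomial, algebraMap_eq]
    have h1 : IsWeightedHomogeneous wt
        (w.prod fun v n => (∑ k : Fin r, X (k, v) : MvPolynomial (Fin r × σ) K) ^ n)
        (∑ v ∈ w.support, w v • Finsupp.single v 1) := by
      refine IsWeightedHomogeneous.prod _ _ _ fun v _ => IsWeightedHomogeneous.pow ?_ _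
      exact IsWeightedHomogeneous.sum _ _ _ fun k _ => isWeightedHomogeneous_X K wt (k, v)
    have h2 : ∑ v ∈ w.support, w v • Finsupp.single v 1 = w := by
      simpa [Finsupp.sum] using w.sum_single
    rw [h2] at h1
    simpa using (isWeightedHomogeneous_C wt a).mul h1
  rw [f.as_sum, map_sum] at hW
  obtain ⟨w, hw, hWw⟩ := Finset.mem_biUnion.1 (support_sum hW)
  have := hmon w (coeff w f) (mem_support_iff.1 hWw)
  rw [hwt] at this
  rwa [this]

/-- Setting `y_{kv}` to zero for `k ≠ c v` reduces the substitution to a renaming. The coefficient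
thus survives in every characteristic, with no multinomial factor. -/
theorem mapDomain_mem_support_splitVars {σ K : Type*} [Field K] {r : ℕ} {f : MvPolynomial σ K}
    {u : σ →₀ ℕ} (hu : u ∈ f.support) (c : σ → Fin r) :
    u.mapDomain (fun v => (c v, v)) ∈ (splitVars K r f).support := by
  classical
  have hinj : Function.Injective fun v => (c v, v) := fun v w h => congrArg Prod.snd h
  rw [mem_support_iff, ← coeff_aeval_ite (fun p : Fin r × σ => c p.2 = p.1)]
  · have : aeval (fun p : Fin r × σ => if c p.2 = p.1 then (X p : MvPolynomial (Fin r × σ) K)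
        else 0) (splitVars K r f) = rename (fun v => (c v, v)) f := by
      rw [splitVars, comp_aeval_apply, rename_eq_aeval]
      congr 2
      funext v
      simp
    rw [this, coeff_rename_mapDomain _ hinj]
    exact mem_support_iff.1 hu
  · intro p hp
    obtain ⟨v, -, rfl⟩ := Finset.mem_image.1 (Finsupp.mapDomain_support hp)
    rfl

/-! ### The scroll order and the upper bound for the initial ideal -/

/-- The comparability relation on the variables of the scroll: the products `x_v x_w` with `v`
related to `w` are the quadratic leading terms of the scroll ideal. -/
def scrollRel {n : ℕ} (lam : Fin n → ℕ) (v w : ScrollVar lam) : Prop :=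
  v.j < w.j ∧ (v.i < w.i ∨ v.j + 2 ≤ w.j)

instance {n : ℕ} (lam : Fin n → ℕ) : Std.Irrefl (scrollRel lam) :=
  ⟨fun _ h => lt_irrefl _ h.1⟩

instance {n : ℕ} (lam : Fin n → ℕ) : IsTrans (ScrollVar lam) (scrollRel lam) :=
  ⟨fun _ _ _ h h' => ⟨h.1.trans h'.1, Or.inr (by have := h.1; have := h'.1; omega)⟩⟩

theorem scrollRel.lt {n : ℕ} {lam : Fin n → ℕ} {v w : ScrollVar lam} (h : scrollRel lam v w) :
    v < w :=
  (ScrollVar.lt_iff v w).2 (Or.inl h.1)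

/-- A monomial supported on an antichain is the smallest one of its multidegree. -/
theorem scrollOrder_le_of_weight_eq {n : ℕ} {lam : Fin n → ℕ} {u w : ScrollVar lam →₀ ℕ}
    (hu : ∀ a ∈ u.support, ∀ b ∈ u.support, ¬ scrollRel lam a b)
    (h : Finsupp.weight (scrollConfig lam) w = Finsupp.weight (scrollConfig lam) u) :
    (scrollOrder lam).toSyn u ≤ (scrollOrder lam).toSyn w := by
  classical
  have := Fintype.ofFinite (ScrollVar lam)
  by_contra hlt
  obtain ⟨v, hlow, hv⟩ : ∃ v, (∀ x, x < v → w x = u x) ∧ w v < u v := not_le.1 hlt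
  -- A separating functional at the first variable `v` where the exponents differ: it is `-1` at
  -- `v`, nonnegative at later variables, and zero at the later ones not related to `v`. It takes a
  -- larger value on `w` than on `u`.
  let L : (Fin (n + 1) → ℤ) →ₗ[ℤ] ℤ := LinearMap.proj 0 -
    ∑ k : Fin n, ((v.j : ℤ) + if k ≤ v.i then 1 else 0) • LinearMap.proj k.succ
  let ψ : ScrollVar lam → ℤ := fun x => x.j - v.j - if x.i ≤ v.i then 1 else 0
  have hL : ∀ x, L (scrollConfig lam x) = ψ x := by
    intro x
    have : ∀ k : Fin n, scrollConfig lam x k.succ = if k = x.i then 1 else 0 := by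
      intro k
      simp [scrollConfig, Pi.single_apply]
    simp only [L, ψ, LinearMap.sub_apply, LinearMap.sum_apply, LinearMap.smul_apply,
      LinearMap.proj_apply, this, smul_eq_mul, mul_ite, mul_one, mul_zero, Finset.sum_ite_eq',
      Finset.mem_univ, if_true]
    simp [scrollConfig, (Fin.succ_ne_zero _).symm]
    ring
  have hw : ∀ w : ScrollVar lam →₀ ℕ,
      L (Finsupp.weight (scrollConfig lam) w) = ∑ x, (w x : ℤ) * ψ x := by
    intro w
    rw [Finsupp.weight_apply, Finsupp.sum_fintype _ _ (by simp), map_sum]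
    exact Finset.sum_congr rfl fun x _ => by rw [map_nsmul, hL, nsmul_eq_mul]
  have hsum := congrArg L h
  rw [hw, hw] at hsum
  have hψv : ψ v = -1 := by simp [ψ]
  refine absurd hsum (ne_of_gt (Finset.sum_lt_sum (fun x _ => ?_) ⟨v, Finset.mem_univ v, ?_⟩))
  · rcases lt_trichotomy x v with hx | rfl | hx
    · rw [hlow x hx]
    · rw [hψv]
      omega
    · have hpos : 0 ≤ ψ x := by
        rcases (ScrollVar.lt_iff _ _).1 hx with h | h
        · simp only [ψ]
          split_ifs <;> omega
        · simp only [ψ]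
          rw [if_neg (not_le.2 h.2)]
          omega
      have hz : (u x : ℤ) * ψ x = 0 := by
        by_cases hux : u x = 0
        · simp [hux]
        · have hr := hu v (Finsupp.mem_support_iff.2 (by omega)) x
            (Finsupp.mem_support_iff.2 hux)
          have : ψ x = 0 := by
            rcases (ScrollVar.lt_iff _ _).1 hx with h | h
            · have h1 : ¬ v.i < x.i := fun hi => hr ⟨h, Or.inl hi⟩
              have h2 : ¬ v.j + 2 ≤ x.j := fun hj => hr ⟨h, Or.inr hj⟩
              simp only [ψ]
              rw [if_pos (not_lt.1 h1)]
              omega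
            · simp only [ψ]
              rw [if_neg (not_le.2 h.2)]
              omega
          rw [this, mul_zero]
      rw [hz]
      positivity
  · rw [hψv]
    omega

theorem weight_single_apply {κ σ M : Type*} [DecidableEq κ] [AddCommMonoid M] (A : σ → M)
    (W : κ × σ →₀ ℕ) (k : κ) :
    Finsupp.weight (fun p : κ × σ => (Pi.single p.1 (A p.2) : κ → M)) W k =
      Finsupp.weight A (W.curry k) := by
  classical
  induction W using Finsupp.induction_linear with
  | zero =>
    have : (0 : κ × σ →₀ ℕ).curry k = 0 := by ext v; simp [Finsupp.curry_apply]
    rw [this, map_zero, map_zero, Pi.zero_apply]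
  | add W W' h h' =>
    have : (W + W').curry k = W.curry k + W'.curry k := by
      ext v
      simp [Finsupp.curry_apply]
    rw [map_add, Pi.add_apply, h, h', this, map_add]
  | single p a =>
    obtain ⟨l, v⟩ := p
    have : (Finsupp.single (l, v) a).curry k = if l = k then Finsupp.single v a else 0 := by
      ext w
      by_cases hl : l = k <;> simp [hl, Finsupp.single_apply]
    rw [this, Finsupp.weight_single, Pi.smul_apply]
    by_cases hl : l = k
    · subst hl
      simp [Finsupp.weight_single]
    · simp [hl, Ne.symm hl]

theorem hasChain_degree_of_mem_secantIdeal {K : Type*} [Field K] {n : ℕ} {lam : Fin n → ℕ}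
    {r : ℕ} (hr : 1 ≤ r) {f : MvPolynomial (ScrollVar lam) K}
    (hf : f ∈ secantIdeal r (scrollIdeal K lam)) (hf0 : f ≠ 0) :
    HasChain (scrollRel lam) r ((scrollOrder lam).degree f).support := by
  classical
  set u := (scrollOrder lam).degree f with hu
  by_contra hch
  obtain ⟨c₀, hc₀, hR⟩ := exists_antichain_coloring r u.support hch
  obtain ⟨c, hc⟩ : ∃ c : ScrollVar lam → Fin r, ∀ v ∈ u.support, (c v : ℕ) = c₀ v :=
    ⟨fun v => if h : c₀ v < r then ⟨c₀ v, h⟩ else ⟨0, hr⟩, fun v hv => by simp [hc₀ v hv]⟩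
  have hinj : Function.Injective fun v : ScrollVar lam => (c v, v) :=
    fun v w h => congrArg Prod.snd h
  set U := u.mapDomain fun v => (c v, v) with hU
  have hUv : ∀ k v, U (k, v) = if k = c v then u v else 0 := by
    intro k v
    split_ifs with h
    · rw [h]
      exact Finsupp.mapDomain_apply hinj u v
    · refine Finsupp.mapDomain_of_notMem_range _ _ ?_
      rintro ⟨w, hw⟩
      obtain ⟨h1, rfl⟩ := Prod.ext_iff.1 hw
      exact h h1.symm
  have hUsum : ∑ k, U.curry k = u := by
    ext v
    simp [Finsupp.finsetSum_apply, Finsupp.curry_apply, hUv]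
  -- The `k`-th point is the scroll parametrization with its own block of torus parameters, so the
  -- degrees of the `r` parts are recorded separately.
  have hF := aeval_sum_eq_zero_of_mem_joinIdeal hf
    (fun k v => (AddMonoidAlgebra.single (Pi.single k (scrollConfig lam v)) 1 :
      AddMonoidAlgebra K (Fin r → Fin (n + 1) → ℤ))) (by
      intro k p hp
      have hp' : aeval (fun v => (AddMonoidAlgebra.single (scrollConfig lam v) 1 :
        AddMonoidAlgebra K (Fin (n + 1) → ℤ))) p = 0 := hp
      have h2 := congrArg (AddMonoidAlgebra.mapDomainAlgHom K K
        (AddMonoidHom.single (fun _ : Fin r => Fin (n + 1) → ℤ) k)) hp'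
      rw [map_zero, comp_aeval_apply] at h2
      simpa using h2)
  have hF' : aeval (fun p : Fin r × ScrollVar lam => (AddMonoidAlgebra.single
      (Pi.single p.1 (scrollConfig lam p.2)) 1 : AddMonoidAlgebra K (Fin r → Fin (n + 1) → ℤ)))
      (splitVars K r f) = 0 := by
    rw [splitVars, comp_aeval_apply]
    simpa using hF
  obtain ⟨W, hW, hne, hwt⟩ := exists_ne_weight_eq _ hF'
    (mapDomain_mem_support_splitVars (((scrollOrder lam).degree_mem_support_iff f).2 hf0) c)
  have hle : ∀ k, (scrollOrder lam).toSyn (U.curry k) ≤ (scrollOrder lam).toSyn (W.curry k) := by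
    intro k
    refine scrollOrder_le_of_weight_eq (fun a ha b hb => ?_) ?_
    · rw [Finsupp.mem_support_iff, Finsupp.curry_apply, hUv] at ha hb
      simp only [ne_eq, ite_eq_right_iff, Classical.not_imp] at ha hb
      have ha' := Finsupp.mem_support_iff.2 ha.2
      have hb' := Finsupp.mem_support_iff.2 hb.2
      refine hR a ha' b hb' ?_
      rw [← hc a ha', ← hc b hb', ← ha.1, ← hb.1]
    · rw [← weight_single_apply, ← weight_single_apply, hwt]
  obtain ⟨k, hk⟩ : ∃ k, U.curry k ≠ W.curry k := by
    by_contra! h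
    refine hne (Finsupp.ext fun p => ?_)
    have := congrArg (fun x => x p.2) (h p.1)
    simpa [Finsupp.curry_apply] using this.symm
  have hlt : ∑ k, (scrollOrder lam).toSyn (U.curry k) < ∑ k, (scrollOrder lam).toSyn (W.curry k) :=
    Finset.sum_lt_sum (fun k _ => hle k) ⟨k, Finset.mem_univ k,
      (hle k).lt_of_ne fun h => hk ((scrollOrder lam).toSyn.injective h)⟩
  rw [← map_sum (scrollOrder lam).toSyn, ← map_sum (scrollOrder lam).toSyn, hUsum] at hlt
  exact absurd ((scrollOrder lam).le_degree (sum_curry_mem_support hW)) (not_le.2 hlt)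

/-! ### Hankel minors and their leading terms -/

theorem X_mul_X_sub_mem_scrollIdeal {K : Type*} [Field K] {n : ℕ} {lam : Fin n → ℕ}
    {v w v' w' : ScrollVar lam} (hv : v.i = v'.i) (hw : w.i = w'.i)
    (hj : v.j + w.j = v'.j + w'.j) :
    (X v * X w - X v' * X w' : MvPolynomial (ScrollVar lam) K) ∈ scrollIdeal K lam := by
  rw [scrollIdeal, toricIdeal, RingHom.mem_ker]
  have : scrollConfig lam v + scrollConfig lam w = scrollConfig lam v' + scrollConfig lam w' := by
    simp only [scrollConfig]
    have hj' : (v.j : ℤ) + w.j = v'.j + w'.j := mod_cast hj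
    rw [hv, hw, add_add_add_comm, ← Pi.single_add, hj', Pi.single_add, add_add_add_comm]
  simp [AddMonoidAlgebra.single_mul_single, this]

/-- In the Leibniz expansion the terms of `σ` and `σ * swap p q` cancel, which needs no division in
`B`. -/
theorem det_eq_zero_of_two_rows {ι B : Type*} [Fintype ι] [DecidableEq ι] [CommRing B]
    (N : Matrix ι ι B) {p q : ι} (hpq : p ≠ q)
    (h : ∀ a b, N p a * N q b = N p b * N q a) : N.det = 0 := by
  rw [← Matrix.det_transpose, Matrix.det_apply]
  refine Finset.sum_involution (fun σ _ => σ * Equiv.swap p q) (fun σ _ => ?_) (fun σ _ _ => ?_)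
    (fun σ _ => Finset.mem_univ _) (fun σ _ => by simp [mul_assoc])
  · have : ∏ i, N.transpose ((σ * Equiv.swap p q) i) i = ∏ i, N.transpose (σ i) i := by
      have hq : q ∈ Finset.univ.erase p := Finset.mem_erase.2 ⟨hpq.symm, Finset.mem_univ q⟩
      rw [← Finset.mul_prod_erase _ _ (Finset.mem_univ p), ← Finset.mul_prod_erase _ _ hq,
        ← Finset.mul_prod_erase Finset.univ (fun i => N.transpose (σ i) i) (Finset.mem_univ p),
        ← Finset.mul_prod_erase _ (fun i => N.transpose (σ i) i) hq, ← mul_assoc, ← mul_assoc]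
      congr 1
      · simp [Matrix.transpose_apply, h (σ q) (σ p)]
      · refine Finset.prod_congr rfl fun i hi => ?_
        simp only [Finset.mem_erase] at hi
        rw [Equiv.Perm.mul_apply, Equiv.swap_apply_of_ne_of_ne hi.2.1 hi.1]
    rw [this, Equiv.Perm.sign_mul, Equiv.Perm.sign_swap hpq]
    simp
  · intro he
    exact hpq (Equiv.swap_eq_one_iff.1 (mul_eq_left.1 he))

/-- A sum of `r` matrices of rank at most one has no nonzero minors of size `r + 1`. -/
theorem det_sum_eq_zero {B : Type*} [CommRing B] {r : ℕ}
    (A : Fin r → Matrix (Fin (r + 1)) (Fin (r + 1)) B)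
    (h : ∀ k p q a b, A k p a * A k q b = A k p b * A k q a) :
    Matrix.det (∑ k, A k) = 0 := by
  have hsum : Matrix.det (∑ k, A k) =
      ∑ x : Fin (r + 1) → Fin r, Matrix.det (fun p => A (x p) p) := by
    -- Expansion by rows: `x` chooses a summand for each row, and with `r + 1` rows some summand is
    -- chosen twice.
    have := (Matrix.detRowAlternating (n := Fin (r + 1)) (R := B)).toMultilinearMap.map_sum
      (fun p (k : Fin r) => A k p)
    have h2 : (∑ k, A k : Matrix (Fin (r + 1)) (Fin (r + 1)) B) = fun p => ∑ k, A k p := by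
      ext p a
      rw [Matrix.sum_apply, Finset.sum_apply]
    rw [h2]
    exact this
  rw [hsum]
  refine Finset.sum_eq_zero fun x _ => ?_
  obtain ⟨p, q, hne, hx⟩ := Fintype.exists_ne_map_eq_of_card_lt x (by simp)
  refine det_eq_zero_of_two_rows _ hne fun a b => ?_
  rw [← hx]
  exact h (x p) p q a b

theorem det_scrollHankel_mem_secantIdeal (K : Type*) [Field K] {n : ℕ} (lam : Fin n → ℕ) (r : ℕ)
    (col : Fin (r + 1) → Σ i : Fin n, {c : ℕ // c + r ≤ lam i}) :
    ((scrollHankel K lam r).submatrix id col).det ∈ secantIdeal r (scrollIdeal K lam) := by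
  refine mem_joinIdeal_of_forall_aeval fun B _ _ g hg => ?_
  rw [AlgHom.map_det]
  let v : Fin (r + 1) → Fin (r + 1) → ScrollVar lam := fun p a =>
    ⟨(col a).1, (col a).2.1 + p,
      (Nat.add_le_add_left (Nat.le_of_lt_succ p.2) _).trans (col a).2.2⟩
  have : (AlgHom.mapMatrix (aeval fun v => ∑ k, g k v))
      ((scrollHankel K lam r).submatrix id col) = ∑ k, Matrix.of fun p a => g k (v p a) := by
    ext p a
    rw [Matrix.sum_apply]
    exact aeval_X _ _
  rw [this]
  refine det_sum_eq_zero _ fun k p q a b => ?_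
  have := hg k _ (X_mul_X_sub_mem_scrollIdeal (K := K) (v := v p a) (w := v q b) (v' := v q a)
    (w' := v p b) rfl rfl (by simp only [v]; omega))
  simp only [map_sub, map_mul, aeval_X] at this
  rw [Matrix.of_apply, Matrix.of_apply, Matrix.of_apply, Matrix.of_apply, sub_eq_zero.1 this,
    mul_comm]

theorem leadingTerm_eq_monomial {σ K : Type*} [Field K] (m : MonomialOrder σ)
    {f : MvPolynomial σ K} {d : σ →₀ ℕ} (hd : coeff d f = 1)
    (hle : ∀ e ∈ f.support, m.toSyn e ≤ m.toSyn d) : m.leadingTerm f = monomial d 1 := by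
  have hdeg : m.degree f = d := m.toSyn.injective
    (le_antisymm (m.degree_le_iff.2 hle) (m.le_degree (mem_support_iff.2 (by simp [hd]))))
  rw [MonomialOrder.leadingTerm, MonomialOrder.leadingCoeff, hdeg, hd]

/-- At the first index `p` moved by `τ`, the factors before `p` agree. The remaining factors of the
`τ`-term lie in the lower right block away from its corner, and that corner is the largest variable
of the block. -/
theorem scrollOrder_perm_lt {n : ℕ} {lam : Fin n → ℕ} {r : ℕ}
    (e : Fin (r + 1) → Fin (r + 1) → ScrollVar lam)
    (he : ∀ p a b, p ≤ a → p ≤ b → ¬ (a = p ∧ b = p) → e p p < e a b)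
    {τ : Equiv.Perm (Fin (r + 1))} (hτ : τ ≠ 1) :
    (scrollOrder lam).toSyn (∑ q, Finsupp.single (e (τ q) q) 1) <
      (scrollOrder lam).toSyn (∑ q, Finsupp.single (e q q) 1) := by
  classical
  obtain ⟨p, hp, hmin⟩ : ∃ p, τ p ≠ p ∧ ∀ q < p, τ q = q := by
    have hne : (Finset.univ.filter fun q => τ q ≠ q).Nonempty := by
      by_contra h
      refine hτ (Equiv.ext fun q => ?_)
      by_contra hq
      exact h ⟨q, Finset.mem_filter.2 ⟨Finset.mem_univ q, hq⟩⟩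
    refine ⟨_, (Finset.mem_filter.1 (Finset.min'_mem _ hne)).2, fun q hq => ?_⟩
    by_contra h
    exact absurd (Finset.min'_le _ q (Finset.mem_filter.2 ⟨Finset.mem_univ q, h⟩)) (not_le.2 hq)
  have hge : ∀ q, p ≤ q → p ≤ τ q := by
    intro q hq
    by_contra h
    have h1 := τ.injective (hmin _ (not_le.1 h))
    exact h (h1.symm ▸ hq)
  have hlt : ∀ q, p ≤ q → e p p < e (τ q) q := fun q hq =>
    he p _ _ (hge q hq) hq fun h => hp (h.2 ▸ h.1)
  have hlt' : ∀ q, p ≤ q → e p p ≤ e q q := by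
    intro q hq
    rcases hq.eq_or_lt with rfl | h
    · exact le_rfl
    · exact (he p q q hq hq fun h' => h.ne' h'.1).le
  change ∃ v, (∀ x, x < v → (∑ q, Finsupp.single (e (τ q) q) 1 : ScrollVar lam →₀ ℕ) x =
    (∑ q, Finsupp.single (e q q) 1 : ScrollVar lam →₀ ℕ) x) ∧
    (∑ q, Finsupp.single (e (τ q) q) 1 : ScrollVar lam →₀ ℕ) v <
    (∑ q, Finsupp.single (e q q) 1 : ScrollVar lam →₀ ℕ) v
  refine ⟨e p p, fun x hx => ?_, ?_⟩
  · rw [Finsupp.finsetSum_apply, Finsupp.finsetSum_apply]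
    refine Finset.sum_congr rfl fun q _ => ?_
    rcases lt_or_ge q p with h | h
    · rw [hmin q h]
    · rw [Finsupp.single_eq_of_ne' (hx.trans (hlt q h)).ne',
        Finsupp.single_eq_of_ne' (hx.trans_le (hlt' q h)).ne']
  · rw [Finsupp.finsetSum_apply, Finsupp.finsetSum_apply]
    refine Finset.sum_lt_sum (fun q _ => ?_) ⟨p, Finset.mem_univ p, ?_⟩
    · rcases lt_or_ge q p with h | h
      · rw [hmin q h]
      · rw [Finsupp.single_eq_of_ne' (hlt q h).ne']
        exact Nat.zero_le _
    · rw [Finsupp.single_eq_of_ne' (hlt p le_rfl).ne', Finsupp.single_eq_same]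
      exact one_pos

theorem leadingTerm_det_of_diagonal_lt {K : Type*} [Field K] {n : ℕ} {lam : Fin n → ℕ} {r : ℕ}
    (e : Fin (r + 1) → Fin (r + 1) → ScrollVar lam)
    (he : ∀ p a b, p ≤ a → p ≤ b → ¬ (a = p ∧ b = p) → e p p < e a b) :
    (scrollOrder lam).leadingTerm
      (Matrix.of fun p q => (X (e p q) : MvPolynomial (ScrollVar lam) K)).det = ∏ q, X (e q q) := by
  classical
  set m : Equiv.Perm (Fin (r + 1)) → ScrollVar lam →₀ ℕ :=
    fun τ => ∑ q, Finsupp.single (e (τ q) q) 1 with hm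
  have hdet : (Matrix.of fun p q => (X (e p q) : MvPolynomial (ScrollVar lam) K)).det =
      ∑ τ : Equiv.Perm (Fin (r + 1)), monomial (m τ) ((Equiv.Perm.sign τ : ℤ) : K) := by
    rw [Matrix.det_apply']
    refine Finset.sum_congr rfl fun τ _ => ?_
    have : ∏ q, (X (e (τ q) q) : MvPolynomial (ScrollVar lam) K) = monomial (m τ) 1 :=
      (monomial_sum_one _ _).symm
    simp only [Matrix.of_apply]
    rw [this, ← map_intCast (C : K →+* MvPolynomial (ScrollVar lam) K), C_mul_monomial, mul_one]
  have hlt : ∀ τ, τ ≠ 1 → (scrollOrder lam).toSyn (m τ) < (scrollOrder lam).toSyn (m 1) :=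
    fun τ hτ => scrollOrder_perm_lt e he hτ
  have hprod : ∏ q, (X (e q q) : MvPolynomial (ScrollVar lam) K) = monomial (m 1) 1 :=
    (monomial_sum_one _ _).symm
  rw [hprod]
  refine leadingTerm_eq_monomial _ ?_ fun d hd => ?_
  · rw [hdet, coeff_sum, Finset.sum_eq_single_of_mem 1 (Finset.mem_univ _)]
    · simp
    · intro τ _ hτ
      rw [coeff_monomial, if_neg fun h => (hlt τ hτ).ne (congrArg _ h)]
  · rw [hdet] at hd
    obtain ⟨τ, -, hτ⟩ := Finset.mem_biUnion.1 (support_sum hd)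
    obtain rfl := Finset.mem_singleton.1 (support_monomial_subset hτ)
    by_cases h1 : τ = 1
    · rw [h1]
    · exact (hlt τ h1).le

/-- If all `λ_i` agree, then every chain is the diagonal of a minor of the Hankel matrix, whose
leading term is the product of that diagonal. -/
theorem exists_minor_of_chain (K : Type*) [Field K] {n : ℕ} {lam : Fin n → ℕ}
    (heq : ∀ i k, lam i = lam k) {r : ℕ} {c : Fin (r + 1) → ScrollVar lam}
    (hc : ∀ a b, a < b → scrollRel lam (c a) (c b)) :
    ∃ col : Fin (r + 1) → Σ i : Fin n, {c : ℕ // c + r ≤ lam i},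
      Function.Injective col ∧
      (∀ q, scrollHankel K lam r q (col q) = X (c q)) ∧
      (scrollOrder lam).leadingTerm ((scrollHankel K lam r).submatrix id col).det =
        ∏ q, X (c q) := by
  -- If `c a` is to sit in row `a`, its column must start at `j - a`. Along a chain these columns
  -- increase strictly, by start and then by block: a step of one in `j` forces `i` to grow.
  -- Integers avoid truncated subtraction.
  have hmono : StrictMono fun a : Fin (r + 1) =>
      (toLex (((c a).j : ℤ) - (a : ℕ), (c a).i) : ℤ ×ₗ Fin n) := by
    rw [Fin.strictMono_iff_lt_succ]
    intro a
    rw [Prod.Lex.toLex_lt_toLex]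
    have := hc a.castSucc a.succ (Fin.castSucc_lt_succ)
    obtain ⟨h1, h2⟩ := this
    simp only [Fin.val_castSucc, Fin.val_succ]
    rcases h2 with h2 | h2
    · by_cases h3 : (c a.castSucc).j + 1 = (c a.succ).j
      · right
        exact ⟨by omega, h2⟩
      · left
        omega
    · left
      omega
  have hkey : ∀ a b, a < b → (c a).j + (b : ℕ) < (c b).j + a ∨
      (c a).j + (b : ℕ) = (c b).j + a ∧ (c a).i < (c b).i := by
    intro a b hab
    rcases (Prod.Lex.toLex_lt_toLex).1 (hmono hab) with h | ⟨h, h'⟩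
    · left
      simp only at h
      omega
    · right
      simp only at h h'
      exact ⟨by omega, h'⟩
  have hweak : ∀ a b, a ≤ b → (c a).j + (b : ℕ) ≤ (c b).j + a := by
    intro a b hab
    rcases hab.eq_or_lt with rfl | h
    · exact le_rfl
    · rcases hkey a b h with h | h <;> omega
  obtain ⟨col, hcol⟩ : ∃ col : Fin (r + 1) → Σ i : Fin n, {c : ℕ // c + r ≤ lam i},
      ∀ q, (col q).1 = (c q).i ∧ (col q).2.1 + (q : ℕ) = (c q).j := by
    have h0 : ∀ q : Fin (r + 1), (q : ℕ) ≤ (c q).j := fun q => by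
      have := hweak 0 q (Fin.zero_le q)
      rw [Fin.val_zero] at this
      omega
    refine ⟨fun q => ⟨(c q).i, (c q).j - q, ?_⟩, fun q => ⟨rfl, Nat.sub_add_cancel (h0 q)⟩⟩
    -- The column fits since `j_q - q + r ≤ j_r`, which is bounded by the length of the block of the
    -- last element. Equality of the `λ_i` transfers the bound to the block of `c q`.
    have h1 := hweak q (Fin.last r) (Fin.le_last q)
    have h2 := (c (Fin.last r)).j_le
    rw [heq _ (c q).i] at h2
    have := h0 q
    rw [Fin.val_last] at h1
    omega
  let e : Fin (r + 1) → Fin (r + 1) → ScrollVar lam := fun p a =>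
    ⟨(col a).1, (col a).2.1 + p,
      (Nat.add_le_add_left (Nat.le_of_lt_succ p.2) _).trans (col a).2.2⟩
  have hdiag : ∀ q, e q q = c q := fun q => ScrollVar.ext (hcol q).1 (hcol q).2
  have hinj : Function.Injective col := by
    have key : ∀ a b, a < b → col a ≠ col b := by
      intro a b hab h
      have h1 := hcol a
      rw [h] at h1
      have h2 := hcol b
      rcases hkey a b hab with h3 | h3
      · omega
      · exact h3.2.ne (h1.1.symm.trans h2.1)
    intro a b h
    rcases lt_trichotomy a b with hab | hab | hab
    · exact absurd h (key a b hab)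
    · exact hab
    · exact absurd h.symm (key b a hab)
  refine ⟨col, hinj, fun q => congrArg X (hdiag q), ?_⟩
  have he : ∀ p a b, p ≤ a → p ≤ b → ¬ (a = p ∧ b = p) → e p p < e a b := by
    intro p a b hpa hpb hne
    rw [hdiag, ScrollVar.lt_iff]
    change (c p).j < (col b).2.1 + a ∨ (c p).j = (col b).2.1 + a ∧ (c p).i < (col b).1
    have h1 := hcol b
    have hi : (c p).i < (c b).i → (c p).i < (col b).1 := fun h => h.trans_eq h1.1.symm
    rcases hpb.eq_or_lt with rfl | hlt
    · have : p < a := hpa.lt_of_ne fun h => hne ⟨h.symm, rfl⟩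
      left
      omega
    · rcases hkey p b hlt with h | h
      · left
        omega
      · rcases hpa.eq_or_lt with rfl | hlt'
        · right
          exact ⟨by omega, hi h.2⟩
        · left
          omega
  have := leadingTerm_det_of_diagonal_lt (K := K) e he
  simp only [hdiag] at this
  exact this

/-! ### Initial ideals, the complementary graph and the conclusion -/

theorem initialIdeal_secantIdeal_scrollIdeal (K : Type*) [Field K] {n : ℕ} {lam : Fin n → ℕ}
    (heq : ∀ i k, lam i = lam k) {r : ℕ} (hr : 1 ≤ r) :
    initialIdeal (scrollOrder lam) (secantIdeal r (scrollIdeal K lam)) =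
      chainIdeal K (scrollRel lam) r := by
  refine initialIdeal_eq_chainIdeal _ _
    (fun f hf hf0 => hasChain_degree_of_mem_secantIdeal hr hf hf0) fun c hc => ?_
  obtain ⟨col, -, -, hlead⟩ := exists_minor_of_chain K heq hc
  exact ⟨_, det_scrollHankel_mem_secantIdeal K lam r col, hlead⟩

theorem initialIdeal_scrollIdeal (K : Type*) [Field K] {n : ℕ} {lam : Fin n → ℕ}
    (heq : ∀ i k, lam i = lam k) :
    initialIdeal (scrollOrder lam) (scrollIdeal K lam) = chainIdeal K (scrollRel lam) 1 := by
  rw [← initialIdeal_secantIdeal_scrollIdeal K heq le_rfl, secantIdeal_one]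

theorem scrollRel_of_complementaryGraph_adj {K : Type*} [Field K] {n : ℕ} {lam : Fin n → ℕ}
    (heq : ∀ i k, lam i = lam k) {v w : ScrollVar lam}
    (h : (complementaryGraph K (scrollOrder lam) (scrollConfig lam)).Adj v w) :
    scrollRel lam v w ∨ scrollRel lam w v := by
  classical
  by_contra hvw
  -- An unrelated pair would itself be a simplex: powers of `x_v x_w` have support in `{v, w}`,
  -- which contains no chain of two elements.
  refine h.2 {v, w} (fun k hk => ?_) (by simp)
  have hk' : (∏ x ∈ {v, w}, (X x : MvPolynomial (ScrollVar lam) K)) ^ k ∈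
      initialIdeal (scrollOrder lam) (scrollIdeal K lam) := hk
  rw [initialIdeal_scrollIdeal K heq, mem_chainIdeal, Finset.prod_pair h.1] at hk'
  have hmon : ((X v * X w) ^ k : MvPolynomial (ScrollVar lam) K) =
      monomial (k • (Finsupp.single v 1 + Finsupp.single w 1)) 1 := by
    rw [X, X, monomial_mul, monomial_pow, one_mul, one_pow]
  rw [hmon] at hk'
  obtain ⟨c, hc, hmem⟩ := hk' (k • (Finsupp.single v 1 + Finsupp.single w 1)) (by
    rw [mem_support_iff, coeff_monomial, if_pos rfl]
    exact one_ne_zero)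
  have hor : ∀ a, c a = v ∨ c a = w := by
    intro a
    have := hmem a
    by_contra! hne
    rw [Finsupp.mem_support_iff] at this
    simp [hne.1.symm, hne.2.symm] at this
  have h01 := hc 0 1 (by decide)
  rcases hor 0 with h0 | h0 <;> rcases hor 1 with h1 | h1 <;> rw [h0, h1] at h01
  · exact irrefl_of (scrollRel lam) _ h01
  · exact hvw (Or.inl h01)
  · exact hvw (Or.inr h01)
  · exact irrefl_of (scrollRel lam) _ h01

theorem theorem5p9 (K : Type*) [Field K] {n : ℕ} (lam : Fin n → ℕ)
    (hpos : ∀ i, 0 < lam i) (heq : ∀ i k, lam i = lam k) :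
    IsDelightful (scrollOrder lam) (scrollIdeal K lam) ∧
    ∀ (r : ℕ), 1 ≤ r → ∀ s : Finset (ScrollVar lam),
      (complementaryGraph K (scrollOrder lam) (scrollConfig lam)).IsNClique (r + 1) s →
      ∃ (u : Fin (r + 1) → ScrollVar lam)
        (col : Fin (r + 1) → Σ i : Fin n, {c : ℕ // c + r ≤ lam i}),
        StrictMono (fun q => (u q).j) ∧
        (∀ v, v ∈ s ↔ ∃ q, u q = v) ∧
        Function.Injective col ∧
        (∀ q, scrollHankel K lam r q (col q) = MvPolynomial.X (u q)) ∧
        ((scrollHankel K lam r).submatrix id col).det ≠ 0 ∧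
        ((scrollHankel K lam r).submatrix id col).det ∈ secantIdeal r (scrollIdeal K lam) ∧
        (scrollOrder lam).leadingTerm ((scrollHankel K lam r).submatrix id col).det =
          ∏ v ∈ s, MvPolynomial.X v := by
  classical
  refine ⟨fun r hr => ?_, fun r hr s hs => ?_⟩
  · rw [IsRDelightful, initialIdeal_secantIdeal_scrollIdeal K heq (by omega),
      initialIdeal_scrollIdeal K heq, secantIdeal_chainIdeal_one]
  -- Sorting the clique by the order of the variables orients every edge, since `scrollRel` is
  -- contained in that order.
  · let u := s.orderEmbOfFin hs.card_eq
    have hchain : ∀ a b, a < b → scrollRel lam (u a) (u b) := by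
      intro a b hab
      have hlt : u a < u b := u.strictMono hab
      rcases scrollRel_of_complementaryGraph_adj heq
        (hs.isClique (s.orderEmbOfFin_mem hs.card_eq a) (s.orderEmbOfFin_mem hs.card_eq b)
          hlt.ne) with h | h
      · exact h
      · exact absurd h.lt hlt.not_gt
    obtain ⟨col, hinj, hdiag, hlead⟩ := exists_minor_of_chain K heq hchain
    have himage : Finset.univ.image u = s := s.image_orderEmbOfFin_univ hs.card_eq
    refine ⟨u, col, fun a b hab => (hchain a b hab).1, fun v => ?_, hinj, hdiag, fun h0 => ?_,
      det_scrollHankel_mem_secantIdeal K lam r col, ?_⟩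
    · conv_lhs => rw [← himage]
      simp
    · rw [h0, MonomialOrder.leadingTerm_zero] at hlead
      exact Finset.prod_ne_zero_iff.2 (fun q _ => X_ne_zero (u q)) hlead.symm
    · rw [hlead]
      conv_rhs => rw [← himage]
      exact (Finset.prod_image fun a _ b _ h => u.injective h).symm
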